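/- Let $A$ be a bounded linear operator on the real Hilbert space $L_2([0,1])$ with $\dim\operatorname{Ker}A<\infty$, such that the restriction of $A$ to $(\operatorname{Ker}A)^\perp$ is continuously invertible, i.e. it has a continuous inverse defined on the image of $A$ (with the norm of $L_2([0,1])$). For $t\in[0,1]$ put $g(t)=A\mathbf 1_{[0,t]}$. For an integer $k\ge 1$ let $\Delta_k=\{(t_1,\dots,t_k)\in\mathbb R^k : 0\le t_1\le\dots\le t_k\le 1\}$ and, for $\delta>0$, let $\Delta_k^\delta=\{\vec t\in\Delta_k : t_{i+1}-t_i\ge\delta,\ i=1,\dots,k-1\}$. Write $\Delta g(t_i)=g(t_{i+1})-g(t_i)$ for $i=1,\dots,k-1$, and let $G(q_1,\dots,q_m)=\det\big((q_i,q_j)\big)_{i,j=1}^m$ be the Gram determinant (with $G=1$ for the empty family). Then for every $k\ge 1$ and every $\delta>0$ $$\int_{\Delta_k^\delta}\frac{1}{G(\Delta g(t_1),\dots,\Delta g(t_{k-1}))}\,d\vec t<+\infty ,$$ where the integral is with respect to Lebesgue measure on $\mathbb R^k$ and $1/0=+\infty$. -/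

import Mathlib

open MeasureTheory
open scoped ENNReal

noncomputable section

/-- The real Hilbert space `L₂([0,1])` with respect to Lebesgue measure. -/
abbrev L2I : Type := Lp ℝ 2 (volume.restrict (Set.Icc (0 : ℝ) 1))

/-- The class in `L₂([0,1])` of the indicator function of `[0,t]`. -/
def indI (t : ℝ) : L2I :=
  indicatorConstLp 2 (measurableSet_Icc : MeasurableSet (Set.Icc (0 : ℝ) t))
    (measure_ne_top (volume.restrict (Set.Icc (0 : ℝ) 1)) _) (1 : ℝ)

/-- The function `g(t) = A 1_{[0,t]}`. -/
def gCurve (A : L2I →L[ℝ] L2I) (t : ℝ) : L2I := A (indI t)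

/-- The increments `Δg(t_i) = g(t_{i+1}) - g(t_i)`, `i = 1, …, n`, of `g` along `t_1, …, t_{n+1}`. -/
def gIncr (A : L2I →L[ℝ] L2I) {n : ℕ} (t : Fin (n + 1) → ℝ) (i : Fin n) : L2I :=
  gCurve A (t i.succ) - gCurve A (t i.castSucc)

/-- The Gram determinant `G(q_1, …, q_n) = det ((q_i, q_j))`. It is always nonnegative. -/
def gramDet {n : ℕ} (q : Fin n → L2I) : ℝ := (Matrix.gram ℝ q).det

/-- The simplex `Δ_k = {0 ≤ t_1 ≤ … ≤ t_k ≤ 1}`. -/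
def simplexI (k : ℕ) : Set (Fin k → ℝ) :=
  {t | Monotone t ∧ ∀ i, t i ∈ Set.Icc (0 : ℝ) 1}

/-- The off-diagonal part `Δ_k^δ = {t ∈ Δ_k : t_{i+1} - t_i ≥ δ}`, for `k = n + 1`. -/
def simplexOff (n : ℕ) (δ : ℝ) : Set (Fin (n + 1) → ℝ) :=
  {t | t ∈ simplexI (n + 1) ∧ ∀ i : Fin n, δ ≤ t i.succ - t i.castSucc}

/-- The restriction of `A` to `(Ker A)^⊥` is continuously invertible: it is a linear homeomorphism
onto the image of `A`, with the topology induced from `L₂([0,1])`. -/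
def ContInvOffKer (A : L2I →L[ℝ] L2I) : Prop :=
  ∃ e : (LinearMap.ker (A : L2I →ₗ[ℝ] L2I))ᗮ ≃L[ℝ] LinearMap.range (A : L2I →ₗ[ℝ] L2I),
    ∀ x, ((e x : LinearMap.range (A : L2I →ₗ[ℝ] L2I)) : L2I) = A (x : L2I)

end

/-!
Write `K = Ker A`, a finite-dimensional space, and `d(s)` for the distance from `s` to a finite set
`F ⊆ ℝ`. A linear combination `∑ x_i Δg(t_i)` is the image under `A` of the step function
`h = ∑ y_j 1_{[0,t_j]}` whose jumps are, up to sign, the numbers `y_j`, and by invertibility of `A`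
off its kernel the quadratic form of the Gram matrix is at least a constant times `dist(h, K)²`.

The Gram determinant degenerates only when `K` contains such a step function, and the rate matters.
Near a point `x` with `1_{[0,x]} ∈ L`, for `L` of finite dimension, the squared distance from
`1_{[0,s]}` to `L` is at least `|s - x| / 2`, since the normalised indicator function of a shrinking
interval tends weakly to zero. Compactness of `[0,1]` turns this into a bound `c d(s)` for a
suitable `F` (`exists_finite_infDist_le`). Cutting `[0,1]` into windows shorter than `δ`, each of which
contains at most one `t_j`, and applying the bound in each window to the restriction of `K` enlarged by
constants, gives `dist(h, K)² ≥ c ∑ y_j² d(t_j)` (`exists_finite_sum_infDist_le`).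

The jumps `y_0, …, y_n` depend linearly on `x_1, …, x_n` and have sum zero, so any `n` of them are
coordinates. Hence the Gram determinant is at least a constant times `∏_{j ≠ p} d(t_j)` for every `p`,
and, taking geometric means, a constant times `∏_j d(t_j) ^ (n / (n + 1))`
(`exists_prod_infDist_pow_le_gramDet_pow`). As `n / (n + 1) < 1`, the reciprocal of this product is
integrable over `[0,1]^{n+1}`.
-/

open scoped Topology

/-! ### Comparison of determinants -/

/-- Monotonicity of the determinant: if `SᵀS ≤ M` as quadratic forms, then `(det S)² ≤ det M`.
For invertible `S` all eigenvalues of `S⁻ᵀMS⁻¹` are at least one. -/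
theorem sq_det_le_det_of_sum_sq_le {ι : Type*} [Fintype ι] [DecidableEq ι] {M S : Matrix ι ι ℝ}
    (hM : M.IsHermitian) (h : ∀ x : ι → ℝ, ∑ i, (S.mulVec x i) ^ 2 ≤ x ⬝ᵥ M.mulVec x) :
    S.det ^ 2 ≤ M.det := by
  have hpos : M.PosSemidef := Matrix.PosSemidef.of_dotProduct_mulVec_nonneg hM fun x => by
    simpa using (Finset.sum_nonneg fun i _ => sq_nonneg (S.mulVec x i)).trans (h x)
  rcases eq_or_ne S.det 0 with h0 | h0
  · simpa [h0] using hpos.det_nonneg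
  have hu : IsUnit S.det := isUnit_iff_ne_zero.2 h0
  set N := S⁻¹.transpose * M * S⁻¹ with hN
  have hNH : N.IsHermitian := by
    have := Matrix.isHermitian_conjTranspose_mul_mul S⁻¹ hM
    rwa [Matrix.conjTranspose_eq_transpose_of_trivial] at this
  have hev : ∀ i, 1 ≤ hNH.eigenvalues i := by
    intro i
    set v : ι → ℝ := (hNH.eigenvectorBasis i).ofLp with hv
    have h1 : hNH.eigenvalues i = v ⬝ᵥ N.mulVec v := by
      simpa [hv] using hNH.eigenvalues_eq i
    have h2 : v ⬝ᵥ N.mulVec v = (S⁻¹.mulVec v) ⬝ᵥ M.mulVec (S⁻¹.mulVec v) := by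
      rw [hN, ← Matrix.mulVec_mulVec, ← Matrix.mulVec_mulVec, Matrix.dotProduct_mulVec,
        Matrix.vecMul_transpose]
    have h3 := h (S⁻¹.mulVec v)
    rw [Matrix.mulVec_mulVec, Matrix.mul_nonsing_inv _ hu, Matrix.one_mulVec] at h3
    have h4 : ∑ i, v i ^ 2 = 1 := by
      have := hNH.eigenvectorBasis.norm_eq_one i
      rw [← EuclideanSpace.real_norm_sq_eq, this, one_pow]
    rw [h1, h2, ← h4]; exact h3
  have hdet : 1 ≤ N.det := by
    rw [hNH.det_eq_prod_eigenvalues]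
    simpa using Finset.prod_le_prod (s := Finset.univ) (f := fun _ => (1 : ℝ))
      (fun _ _ => zero_le_one) (fun i _ => hev i)
  have : M.det = S.det ^ 2 * N.det := by
    rw [hN, Matrix.det_mul, Matrix.det_mul, Matrix.det_transpose, Matrix.det_nonsing_inv,
      Ring.inverse_eq_inv']
    field_simp
  rw [this]
  exact le_mul_of_one_le_right (sq_nonneg _) hdet

/-! ### Products and negative powers of distances under the integral -/

theorem lintegral_pi_prod_eq_pow {f : ℝ → ℝ≥0∞} (hf : Measurable f) (μ : Measure ℝ) [SigmaFinite μ]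
    (n : ℕ) : ∫⁻ t, ∏ i, f (t i) ∂(Measure.pi fun _ : Fin n => μ) = (∫⁻ s, f s ∂μ) ^ n := by
  induction n with
  | zero => simp
  | succ n ih =>
    have e := (measurePreserving_piFinSuccAbove (fun _ : Fin (n + 1) => μ) 0).symm
    rw [← e.lintegral_comp_emb (MeasurableEquiv.measurableEmbedding _)]
    have : ∀ p : ℝ × (Fin n → ℝ), ∏ i, f ((MeasurableEquiv.piFinSuccAbove
        (fun _ : Fin (n + 1) => ℝ) 0).symm p i) = f p.1 * ∏ i, f (p.2 i) := by
      intro p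
      simp [Fin.prod_univ_succ, MeasurableEquiv.piFinSuccAbove]
    simp_rw [this]
    rw [lintegral_prod_mul (f := f) (g := fun t : Fin n → ℝ => ∏ i, f (t i)) hf.aemeasurable
      (Measurable.aemeasurable (by fun_prop)), ih, pow_succ']

theorem lintegral_infDist_rpow_neg_lt_top {F : Set ℝ} (hF : F.Finite) (hne : F.Nonempty) {θ : ℝ}
    (h1 : θ < 1) :
    ∫⁻ s in Set.Icc (0 : ℝ) 1, ENNReal.ofReal (Metric.infDist s F) ^ (-θ) < ∞ := by
  have key : ∀ x : ℝ, ∫⁻ s in Set.Icc (0 : ℝ) 1, ENNReal.ofReal |s - x| ^ (-θ) < ∞ := by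
    intro x
    have hint : IntegrableOn (fun s : ℝ => |s - x| ^ (-θ)) (Set.Icc 0 1) := by
      have hall : ∀ a b : ℝ, IntervalIntegrable (fun s : ℝ => |s| ^ (-θ)) volume a b := by
        have hp : ∀ b : ℝ, 0 ≤ b → IntervalIntegrable (fun s : ℝ => |s| ^ (-θ)) volume 0 b := by
          intro b hb
          refine (intervalIntegral.intervalIntegrable_rpow' (a := 0) (b := b) (r := -θ)
            (by linarith)).congr ?_
          intro s hs
          rw [Set.uIoc_of_le hb] at hs
          simp only [abs_of_pos hs.1]
        have hz : ∀ b : ℝ, IntervalIntegrable (fun s : ℝ => |s| ^ (-θ)) volume 0 b := by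
          intro b
          rcases le_total 0 b with hb | hb
          · exact hp b hb
          · have := (hp (-b) (by linarith)).comp_sub_left 0
            simpa using this
        exact fun a b => (hz a).symm.trans (hz b)
      have := (hall (0 - x) (1 - x)).comp_sub_right x
      simp only [sub_add_cancel] at this
      rwa [intervalIntegrable_iff_integrableOn_Icc_of_le zero_le_one] at this
    have hlt := hint.lintegral_lt_top
    refine lt_of_eq_of_lt (lintegral_congr_ae ?_) hlt
    -- At `s = x` the real power has the junk value `0 ^ (-θ) = 0`, the extended one is `∞`.
    have : ∀ᵐ s ∂(volume.restrict (Set.Icc (0 : ℝ) 1)), s ≠ x :=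
      ae_restrict_of_ae (Measure.ae_ne volume x)
    filter_upwards [this] with s hs
    exact ENNReal.ofReal_rpow_of_pos (abs_pos.2 (sub_ne_zero.2 hs))
  calc ∫⁻ s in Set.Icc (0 : ℝ) 1, ENNReal.ofReal (Metric.infDist s F) ^ (-θ)
      ≤ ∫⁻ s in Set.Icc (0 : ℝ) 1, ∑ x ∈ hF.toFinset, ENNReal.ofReal |s - x| ^ (-θ) := by
        refine lintegral_mono fun s => ?_
        obtain ⟨x, hx, he⟩ := hF.isCompact.exists_infDist_eq_dist hne s
        rw [he, Real.dist_eq]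
        exact Finset.single_le_sum (f := fun x => ENNReal.ofReal |s - x| ^ (-θ))
          (fun _ _ => zero_le) (hF.mem_toFinset.2 hx)
    _ = ∑ x ∈ hF.toFinset, ∫⁻ s in Set.Icc (0 : ℝ) 1, ENNReal.ofReal |s - x| ^ (-θ) :=
        lintegral_finsetSum _ fun x _ => by fun_prop
    _ < ∞ := ENNReal.sum_lt_top.2 fun x _ => key x

/-! ### Restriction to a subset of the interval -/

/-- Multiplication by the indicator function of a measurable set `E`, as a linear operator on
`L₂([0,1])`. -/
noncomputable def mulInd (E : Set ℝ) (hE : MeasurableSet E) : L2I →ₗ[ℝ] L2I where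
  toFun f := ((Lp.memLp f).indicator hE).toLp _
  map_add' f g := by
    rw [← MemLp.toLp_add]
    refine MemLp.toLp_congr _ _ ?_
    filter_upwards [Lp.coeFn_add f g] with x hx
    rw [Pi.add_apply]
    by_cases h : x ∈ E
    · simp only [Set.indicator_of_mem h, hx, Pi.add_apply]
    · simp only [Set.indicator_of_notMem h, add_zero]
  map_smul' c f := by
    rw [RingHom.id_apply, ← MemLp.toLp_const_smul]
    refine MemLp.toLp_congr _ _ ?_
    filter_upwards [Lp.coeFn_smul c f] with x hx
    rw [Pi.smul_apply]
    by_cases h : x ∈ E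
    · simp only [Set.indicator_of_mem h, hx, Pi.smul_apply]
    · simp only [Set.indicator_of_notMem h, smul_zero]

theorem coeFn_mulInd {E : Set ℝ} (hE : MeasurableSet E) (f : L2I) :
    mulInd E hE f =ᵐ[volume.restrict (Set.Icc 0 1)] E.indicator f := by
  have hf : MemLp (E.indicator f) 2 (volume.restrict (Set.Icc (0 : ℝ) 1)) :=
    (Lp.memLp f).indicator hE
  have h : mulInd E hE f = hf.toLp _ := rfl
  rw [h]
  exact hf.coeFn_toLp

theorem norm_mulInd_sq {E : Set ℝ} (hE : MeasurableSet E) (f : L2I) :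
    ‖mulInd E hE f‖ ^ 2 = ∫ x in E, f x ^ 2 ∂(volume.restrict (Set.Icc 0 1)) := by
  rw [← real_inner_self_eq_norm_sq, L2.inner_def, ← integral_indicator hE]
  refine integral_congr_ae ?_
  filter_upwards [coeFn_mulInd hE f] with x hx
  rw [hx]
  by_cases h : x ∈ E <;> simp [h, sq]

theorem inner_mulInd {E : Set ℝ} (hE : MeasurableSet E) (f g : L2I) :
    inner ℝ f (mulInd E hE g) = inner ℝ (mulInd E hE f) g := by
  rw [L2.inner_def, L2.inner_def]
  refine integral_congr_ae ?_
  filter_upwards [coeFn_mulInd hE f, coeFn_mulInd hE g] with x hf hg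
  rw [hf, hg]
  by_cases h : x ∈ E <;> simp [h]

/-- Bessel-type inequality for the restrictions of `f` to pairwise disjoint sets. -/
theorem sum_norm_mulInd_sq_le {ι : Type*} (s : Finset ι) {E : ι → Set ℝ}
    (hE : ∀ i, MeasurableSet (E i)) (hd : (s : Set ι).Pairwise (Function.onFun Disjoint E))
    (f : L2I) : ∑ i ∈ s, ‖mulInd (E i) (hE i) f‖ ^ 2 ≤ ‖f‖ ^ 2 := by
  have hi : Integrable (fun x => f x ^ 2) (volume.restrict (Set.Icc (0 : ℝ) 1)) :=
    (Lp.memLp f).integrable_sq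
  simp_rw [norm_mulInd_sq]
  rw [← integral_biUnion_finset s (fun i _ => hE i) hd (fun i _ => hi.integrableOn),
    ← real_inner_self_eq_norm_sq, L2.inner_def]
  refine (setIntegral_le_integral hi (Filter.Eventually.of_forall fun x => sq_nonneg _)).trans
    (le_of_eq ?_)
  simp [sq]

/-! ### The curve of indicator functions -/

/-- The representative `1_{(-∞,t]}` is correct for every real `t`, because only arguments in `[0,1]`
matter; it makes the formulas below hold without constraints on `t`. -/
theorem coeFn_indI (t : ℝ) :
    indI t =ᵐ[volume.restrict (Set.Icc 0 1)] (Set.Iic t).indicator fun _ => (1 : ℝ) := by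
  filter_upwards [indicatorConstLp_coeFn (p := 2) (μ := volume.restrict (Set.Icc (0 : ℝ) 1))
    (hs := (measurableSet_Icc : MeasurableSet (Set.Icc (0 : ℝ) t)))
    (hμs := measure_ne_top _ _) (c := (1 : ℝ)), ae_restrict_mem measurableSet_Icc] with x hx h01
  rw [indI, hx]
  by_cases h : x ≤ t <;> simp [h, h01.1]

theorem mulInd_indI (a b t : ℝ) :
    mulInd (Set.Ioc a b) measurableSet_Ioc (indI t) = indI (max a (min b t)) - indI a := by
  refine Lp.ext ?_
  filter_upwards [coeFn_mulInd (measurableSet_Ioc (a := a) (b := b)) (indI t), coeFn_indI t,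
    coeFn_indI a, coeFn_indI (max a (min b t)), Lp.coeFn_sub (indI (max a (min b t))) (indI a)]
    with x h1 h2 h3 h4 h5
  rw [h1, h5, Pi.sub_apply, h3, h4]
  simp only [Set.indicator_apply, Set.mem_Ioc, Set.mem_Iic, h2, le_max_iff, le_min_iff]
  grind

theorem mulInd_uIoc_indI_sub (x s : ℝ) :
    mulInd (Set.uIoc x s) measurableSet_uIoc (indI s - indI x) = indI s - indI x := by
  refine Lp.ext ?_
  filter_upwards [coeFn_mulInd (measurableSet_uIoc (a := x) (b := s)) (indI s - indI x),
    coeFn_indI s, coeFn_indI x, Lp.coeFn_sub (indI s) (indI x)] with y h1 h2 h3 h4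
  rw [h1]
  by_cases h : y ∈ Set.uIoc x s
  · rw [Set.indicator_of_mem h]
  · rw [Set.indicator_of_notMem h, h4, Pi.sub_apply, h2, h3]
    simp only [Set.indicator_apply, Set.mem_Iic]
    rw [Set.mem_uIoc] at h
    grind

theorem volume_restrict_uIoc {x s : ℝ} (hx : x ∈ Set.Icc (0 : ℝ) 1) (hs : s ∈ Set.Icc (0 : ℝ) 1) :
    volume.restrict (Set.Icc 0 1) (Set.uIoc x s) = ENNReal.ofReal |s - x| := by
  rw [Measure.restrict_apply measurableSet_uIoc, Set.inter_eq_left.2, Real.volume_uIoc]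
  exact Set.uIoc_subset_uIcc.trans (Set.uIcc_subset_Icc hx hs)

theorem norm_indI_sub_sq {x s : ℝ} (hx : x ∈ Set.Icc (0 : ℝ) 1) (hs : s ∈ Set.Icc (0 : ℝ) 1) :
    ‖indI s - indI x‖ ^ 2 = |s - x| := by
  rw [← mulInd_uIoc_indI_sub, norm_mulInd_sq]
  have : ∫ y in Set.uIoc x s, (indI s - indI x : L2I) y ^ 2 ∂(volume.restrict (Set.Icc 0 1))
      = ∫ y in Set.uIoc x s, (1 : ℝ) ∂(volume.restrict (Set.Icc 0 1)) := by
    refine setIntegral_congr_ae measurableSet_uIoc ?_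
    filter_upwards [coeFn_indI s, coeFn_indI x, Lp.coeFn_sub (indI s) (indI x)] with y h2 h3 h4 hy
    simp only [h4, Pi.sub_apply, h2, h3, Set.indicator_apply, Set.mem_Iic]
    rw [Set.mem_uIoc] at hy
    grind
  rw [this, setIntegral_const, measureReal_def, volume_restrict_uIoc hx hs,
    ENNReal.toReal_ofReal (abs_nonneg _), smul_eq_mul, mul_one]

theorem tendsto_norm_mulInd_uIoc (f : L2I) {x : ℝ} (hx : x ∈ Set.Icc (0 : ℝ) 1) :
    Filter.Tendsto (fun s => ‖mulInd (Set.uIoc x s) measurableSet_uIoc f‖)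
      (𝓝[Set.Icc 0 1] x) (𝓝 0) := by
  have hi : Integrable (fun x => f x ^ 2) (volume.restrict (Set.Icc (0 : ℝ) 1)) :=
    (Lp.memLp f).integrable_sq
  have hs : Filter.Tendsto (volume.restrict (Set.Icc (0 : ℝ) 1) ∘ fun s => Set.uIoc x s)
      (𝓝[Set.Icc 0 1] x) (𝓝 0) := by
    have h1 : Filter.Tendsto (fun s => ENNReal.ofReal |s - x|) (𝓝[Set.Icc 0 1] x) (𝓝 0) := by
      have : Continuous fun s => ENNReal.ofReal |s - x| :=
      ENNReal.continuous_ofReal.comp (by fun_prop)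
      have h := this.tendsto x
      simp only [sub_self, abs_zero, ENNReal.ofReal_zero] at h
      exact h.mono_left nhdsWithin_le_nhds
    refine h1.congr' ?_
    filter_upwards [self_mem_nhdsWithin] with s hs
    exact (volume_restrict_uIoc hx hs).symm
  have h := (hi.tendsto_setIntegral_nhds_zero hs).sqrt
  rw [Real.sqrt_zero] at h
  refine h.congr fun s => ?_
  rw [← norm_mulInd_sq measurableSet_uIoc f, Real.sqrt_sq (norm_nonneg _)]

/-! ### Distance from the curve to a finite-dimensional space -/

/-- The elements of a finite-dimensional space have little mass near a point, uniformly: expand in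
an orthonormal basis. -/
theorem eventually_norm_mulInd_uIoc_le (L : Submodule ℝ L2I) [FiniteDimensional ℝ L] {x ε : ℝ}
    (hx : x ∈ Set.Icc (0 : ℝ) 1) (hε : 0 < ε) :
    ∀ᶠ s in 𝓝[Set.Icc 0 1] x, ∀ l ∈ L,
      ‖mulInd (Set.uIoc x s) measurableSet_uIoc l‖ ≤ ε * ‖l‖ := by
  have b := stdOrthonormalBasis ℝ L
  have ht : Filter.Tendsto
      (fun s => ∑ j, ‖mulInd (Set.uIoc x s) measurableSet_uIoc (b j : L2I)‖)
      (𝓝[Set.Icc 0 1] x) (𝓝 0) := by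
    simpa using tendsto_finsetSum Finset.univ
      fun j _ => tendsto_norm_mulInd_uIoc (b j : L2I) hx
  filter_upwards [ht.eventually_lt_const hε] with s hs l hl
  have hl' : l = ∑ j, b.repr ⟨l, hl⟩ j • (b j : L2I) := by
    have := congrArg (Subtype.val) (b.sum_repr ⟨l, hl⟩)
    simpa using this.symm
  calc ‖mulInd (Set.uIoc x s) measurableSet_uIoc l‖
      = ‖∑ j, b.repr ⟨l, hl⟩ j • mulInd (Set.uIoc x s) measurableSet_uIoc (b j : L2I)‖ := by
        conv_lhs => rw [hl', map_sum]
        simp only [map_smul]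
    _ ≤ ∑ j, ‖l‖ * ‖mulInd (Set.uIoc x s) measurableSet_uIoc (b j : L2I)‖ := by
        refine (norm_sum_le _ _).trans (Finset.sum_le_sum fun j _ => ?_)
        rw [norm_smul]
        gcongr
        calc ‖b.repr ⟨l, hl⟩ j‖ ≤ ‖b.repr ⟨l, hl⟩‖ := PiLp.norm_apply_le _ j
          _ = ‖l‖ := by rw [b.repr.norm_map]; rfl
    _ ≤ ε * ‖l‖ := by
        rw [← Finset.mul_sum, mul_comm]
        gcongr

/-- At a point `x` where the curve `indI` lies on `L`, it leaves `L` at least as fast as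
`|s - x|`: the direction of `indI s - indI x`, an indicator function of a shrinking interval, becomes
orthogonal to `L`. -/
theorem eventually_half_abs_sub_le (L : Submodule ℝ L2I) [FiniteDimensional ℝ L] {x : ℝ}
    (hx : x ∈ Set.Icc (0 : ℝ) 1) (hxL : indI x ∈ L) :
    ∀ᶠ s in 𝓝[Set.Icc 0 1] x, ∀ l ∈ L, 1 / 2 * |s - x| ≤ ‖indI s - l‖ ^ 2 := by
  filter_upwards [eventually_norm_mulInd_uIoc_le L hx (ε := 1 / 2) (by norm_num),
    self_mem_nhdsWithin] with s hs hs01 l hl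
  have h1 := hs (l - indI x) (L.sub_mem hl hxL)
  set w := indI s - indI x with hw
  set m := l - indI x with hm
  have h2 : indI s - l = w - m := by rw [hw, hm]; abel
  have h3 : inner ℝ w m ≤ ‖w‖ * (1 / 2 * ‖m‖) := by
    have hw' : mulInd (Set.uIoc x s) measurableSet_uIoc w = w := mulInd_uIoc_indI_sub x s
    rw [← hw', ← inner_mulInd, hw']
    refine (real_inner_le_norm _ _).trans ?_
    gcongr
  have h4 : |s - x| = ‖w‖ ^ 2 := (norm_indI_sub_sq hx hs01).symm
  -- `‖w - m‖² ≥ ‖w‖² - ‖w‖‖m‖ + ‖m‖² ≥ ‖w‖² / 2`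
  have h5 := norm_sub_sq_real w m
  rw [h2, h4, h5]
  nlinarith [sq_nonneg (‖w‖ - 2 * ‖m‖), sq_nonneg ‖w‖, sq_nonneg ‖m‖, sq_nonneg (‖w‖ - ‖m‖)]

/-- The squared distance from `indI s` to a finite-dimensional space dominates the distance from
`s` to a suitable finite set. By compactness of `[0,1]` a bound `c |s - x| ≤ dist²` near each point `x`
is enough; where `indI x ∉ L` such a bound holds by continuity. -/
theorem exists_finite_infDist_le (L : Submodule ℝ L2I) [FiniteDimensional ℝ L] :
    ∃ F : Set ℝ, F.Finite ∧ F.Nonempty ∧ ∃ c > 0, ∀ s ∈ Set.Icc (0 : ℝ) 1, ∀ l ∈ L,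
      c * Metric.infDist s F ≤ ‖indI s - l‖ ^ 2 := by
  refine isCompact_Icc.induction_on (s := Set.Icc (0 : ℝ) 1) (p := fun S =>
    ∃ F : Set ℝ, F.Finite ∧ F.Nonempty ∧ ∃ c > 0, ∀ s ∈ S, ∀ l ∈ L,
      c * Metric.infDist s F ≤ ‖indI s - l‖ ^ 2) ?_ ?_ ?_ ?_
  · exact ⟨{0}, by simp, by simp, 1, one_pos, by simp⟩
  · rintro S T hST ⟨F, hF, hne, c, hc, h⟩
    exact ⟨F, hF, hne, c, hc, fun s hs => h s (hST hs)⟩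
  · rintro S T ⟨F, hF, hne, c, hc, h⟩ ⟨F', hF', hne', c', hc', h'⟩
    refine ⟨F ∪ F', hF.union hF', hne.inl, min c c', lt_min hc hc', ?_⟩
    rintro s (hs | hs) l hl
    · refine le_trans ?_ (h s hs l hl)
      exact mul_le_mul (min_le_left _ _) (Metric.infDist_le_infDist_of_subset
        Set.subset_union_left hne) Metric.infDist_nonneg hc.le
    · refine le_trans ?_ (h' s hs l hl)
      exact mul_le_mul (min_le_right _ _) (Metric.infDist_le_infDist_of_subset
        Set.subset_union_right hne') Metric.infDist_nonneg hc'.le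
  · intro x hx
    have key : ∃ c > 0, ∀ᶠ s in 𝓝[Set.Icc 0 1] x, ∀ l ∈ L, c * |s - x| ≤ ‖indI s - l‖ ^ 2 := by
      by_cases hxL : indI x ∈ L
      · exact ⟨1 / 2, by norm_num, eventually_half_abs_sub_le L hx hxL⟩
      · have hpos : 0 < Metric.infDist (indI x) L :=
          (L.closed_of_finiteDimensional.notMem_iff_infDist_pos ⟨0, L.zero_mem⟩).1 hxL
        set r := Metric.infDist (indI x) L with hr
        have ht : Filter.Tendsto (fun s => |s - x|) (𝓝[Set.Icc 0 1] x) (𝓝 0) := by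
          have : Continuous fun s => |s - x| := by fun_prop
          have h := this.tendsto x
          simp only [sub_self, abs_zero] at h
          exact h.mono_left nhdsWithin_le_nhds
        refine ⟨1, one_pos, ?_⟩
        filter_upwards [ht.eventually_lt_const (u := r ^ 2 / 4) (by positivity),
          self_mem_nhdsWithin] with s hs hs01 l hl
        have h1 : r ≤ ‖indI x - l‖ := by
          rw [← dist_eq_norm]; exact Metric.infDist_le_dist_of_mem hl
        have h2 : ‖indI x - l‖ ≤ ‖indI s - indI x‖ + ‖indI s - l‖ := by
          have : indI x - l = -(indI s - indI x) + (indI s - l) := by abel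
          rw [this]; exact (norm_add_le _ _).trans (by rw [norm_neg])
        have h3 := norm_indI_sub_sq hx hs01
        have h4 : ‖indI s - indI x‖ < r / 2 :=
          lt_of_pow_lt_pow_left₀ 2 (by positivity) (by rw [h3]; linarith [hs])
        have h5 : r / 2 ≤ ‖indI s - l‖ := by linarith
        calc 1 * |s - x| ≤ (r / 2) ^ 2 := by linarith
          _ ≤ ‖indI s - l‖ ^ 2 := by gcongr
    obtain ⟨c, hc, h⟩ := key
    refine ⟨_, h, {x}, by simp, by simp, c, hc, fun s hs l hl => ?_⟩
    rw [Metric.infDist_singleton, Real.dist_eq]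
    exact hs l hl

/-! ### Distance from step functions to a finite-dimensional space -/

theorem le_sub_of_mem_simplexOff {n : ℕ} {δ : ℝ} {t : Fin (n + 1) → ℝ} (ht : t ∈ simplexOff n δ)
    {i j : Fin (n + 1)} (hij : i < j) : δ ≤ t j - t i := by
  have hi : i ≠ Fin.last n := (hij.trans_le (Fin.le_last j)).ne
  obtain ⟨i', rfl⟩ := Fin.exists_castSucc_eq.2 hi
  have h1 := ht.2 i'
  have h2 := ht.1.1 (Fin.castSucc_lt_iff_succ_le.1 hij)
  linarith

/-- If `t j` is the only one of the points `t i` inside `(a, b)`, the restriction of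
`∑ i, y i • indI (t i) - k` to `(a, b]` is `y j • indI (t j)` up to a space that depends on `a` and `b`
only. -/
theorem mulInd_sum_sub_sub_mem {ι : Type*} [Fintype ι] [DecidableEq ι] (K : Submodule ℝ L2I)
    {k : L2I} (hk : k ∈ K) {a b : ℝ} {t : ι → ℝ} (y : ι → ℝ) {j : ι} (hj : t j ∈ Set.Icc a b)
    (h : ∀ i, i ≠ j → t i ≤ a ∨ b ≤ t i) :
    mulInd (Set.Ioc a b) measurableSet_Ioc (∑ i, y i • indI (t i) - k) - y j • indI (t j) ∈
      K.map (mulInd (Set.Ioc a b) measurableSet_Ioc) ⊔ Submodule.span ℝ {indI a, indI b} := by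
  set L := K.map (mulInd (Set.Ioc a b) measurableSet_Ioc) ⊔ Submodule.span ℝ {indI a, indI b}
  have hab : a ≤ b := hj.1.trans hj.2
  have ha : indI a ∈ L := Submodule.mem_sup_right (Submodule.subset_span (by simp))
  have hb : indI b ∈ L := Submodule.mem_sup_right (Submodule.subset_span (by simp))
  have hk' : mulInd (Set.Ioc a b) measurableSet_Ioc k ∈ L :=
    Submodule.mem_sup_left (Submodule.mem_map_of_mem hk)
  rw [map_sub, map_sum, ← Finset.add_sum_erase _ _ (Finset.mem_univ j)]
  have h1 : ∑ i ∈ Finset.univ.erase j, mulInd (Set.Ioc a b) measurableSet_Ioc (y i • indI (t i))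
      ∈ L := by
    refine Submodule.sum_mem _ fun i hi => ?_
    rw [map_smul, mulInd_indI]
    refine L.smul_mem _ (L.sub_mem ?_ ha)
    rcases h i (Finset.ne_of_mem_erase hi) with h | h
    · rwa [max_eq_left ((min_le_right _ _).trans h)]
    · rwa [min_eq_left h, max_eq_right hab]
  have h2 : mulInd (Set.Ioc a b) measurableSet_Ioc (y j • indI (t j)) - y j • indI (t j) ∈ L := by
    rw [map_smul, mulInd_indI, min_eq_right hj.2, max_eq_right hj.1, smul_sub, sub_sub_cancel_left]
    exact L.neg_mem (L.smul_mem _ ha)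
  have := L.sub_mem (L.add_mem h2 h1) hk'
  convert this using 1
  abel

/-- Step functions with well-separated jumps `y j` at `t j` are far from `K`, with a contribution
`y j ^ 2 * dist (t j, F)` of every single jump. The windows `((p - 1) / N, p / N]` with `1 < N δ` each
contain at most one of the `t j`, and there are only finitely many of them. -/
theorem exists_finite_sum_infDist_le (K : Submodule ℝ L2I) [FiniteDimensional ℝ K] (n : ℕ) {δ : ℝ}
    (hδ : 0 < δ) :
    ∃ F : Set ℝ, F.Finite ∧ F.Nonempty ∧ ∃ c > 0, ∀ t ∈ simplexOff n δ, ∀ y : Fin (n + 1) → ℝ,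
      ∀ k ∈ K, ∑ j, c * Metric.infDist (t j) F * y j ^ 2 ≤ ‖∑ j, y j • indI (t j) - k‖ ^ 2 := by
  obtain ⟨N, hN⟩ := exists_nat_gt (1 / δ)
  have hNpos : (0 : ℝ) < N := (by positivity : 0 < 1 / δ).trans hN
  have hNδ : 1 < N * δ := by rwa [div_lt_iff₀ hδ] at hN
  set α : ℕ → ℝ := fun p => ((p : ℝ) - 1) / N with hα
  set β : ℕ → ℝ := fun p => (p : ℝ) / N with hβ
  set L : ℕ → Submodule ℝ L2I := fun p =>
    K.map (mulInd (Set.Ioc (α p) (β p)) measurableSet_Ioc) ⊔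
      Submodule.span ℝ {indI (α p), indI (β p)} with hL
  have hfin : ∀ p, FiniteDimensional ℝ (L p) := fun p => by
    have : FiniteDimensional ℝ (Submodule.span ℝ {indI (α p), indI (β p)}) :=
      FiniteDimensional.span_of_finite ℝ (by simp)
    exact Submodule.finiteDimensional_sup _ _
  choose F hF hne c hc hcF using fun p => exists_finite_infDist_le (L p)
  have hrange : (Finset.range (N + 1)).Nonempty := ⟨0, by simp⟩
  set c₀ := (Finset.range (N + 1)).inf' hrange c with hc₀
  have hc₀pos : 0 < c₀ := (Finset.lt_inf'_iff _).2 fun p _ => hc p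
  refine ⟨⋃ p ∈ Finset.range (N + 1), F p, (Finset.range (N + 1)).finite_toSet.biUnion
    fun p _ => hF p, ?_, c₀, hc₀pos, fun t ht y k hk => ?_⟩
  · obtain ⟨x, hx⟩ := hne 0
    exact ⟨x, Set.mem_biUnion (by simp) hx⟩
  -- The index of the window that contains `t j`; it is `0` when `t j = 0`.
  set P : Fin (n + 1) → ℕ := fun j => ⌈(N : ℝ) * t j⌉₊ with hP
  have ht01 : ∀ j, t j ∈ Set.Icc (0 : ℝ) 1 := ht.1.2
  have hP1 : ∀ j, N * t j ≤ P j := fun j => Nat.le_ceil _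
  have hP2 : ∀ j, (P j : ℝ) < N * t j + 1 := fun j =>
    Nat.ceil_lt_add_one (mul_nonneg hNpos.le (ht01 j).1)
  have hPN : ∀ j, P j ∈ Finset.range (N + 1) := fun j => by
    rw [Finset.mem_range, Nat.lt_succ_iff]
    exact Nat.ceil_le.2 (mul_le_of_le_one_right hNpos.le (ht01 j).2)
  have hsep : ∀ {i j : Fin (n + 1)}, i < j → N * t i + 1 < N * t j := fun {i j} hij => by
    have h := mul_le_mul_of_nonneg_left (le_sub_of_mem_simplexOff ht hij) hNpos.le
    linarith
  have hlt : ∀ {i j : Fin (n + 1)}, i < j → (P i : ℝ) + 1 ≤ P j := fun {i j} hij => by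
    have : (P i : ℝ) < P j := by linarith [hP2 i, hP1 j, hsep hij]
    exact_mod_cast this
  have hdisj : ∀ {i j : Fin (n + 1)}, i < j →
      Disjoint (Set.Ioc (α (P i)) (β (P i))) (Set.Ioc (α (P j)) (β (P j))) := fun {i j} hij => by
    refine Set.Ioc_disjoint_Ioc_of_le ?_
    simp only [hα, hβ]
    gcongr
    linarith [hlt hij]
  refine le_trans (Finset.sum_le_sum fun j _ => ?_)
    (sum_norm_mulInd_sq_le Finset.univ (E := fun j => Set.Ioc (α (P j)) (β (P j)))
      (fun _ => measurableSet_Ioc) ?_ _)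
  · have hm := mulInd_sum_sub_sub_mem K hk y (t := t) (j := j) (a := α (P j)) (b := β (P j))
      ⟨?_, ?_⟩ ?_
    · set z := mulInd (Set.Ioc (α (P j)) (β (P j))) measurableSet_Ioc (∑ i, y i • indI (t i) - k)
        with hz
      rcases eq_or_ne (y j) 0 with h0 | h0
      · rw [h0]; simp
      have h1 := hcF (P j) (t j) (ht01 j) (-((y j)⁻¹ • (z - y j • indI (t j))))
        ((L (P j)).neg_mem ((L (P j)).smul_mem _ hm))
      have h2 : z = y j • (indI (t j) - -((y j)⁻¹ • (z - y j • indI (t j)))) := by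
        rw [sub_neg_eq_add, smul_add, smul_inv_smul₀ h0]; abel
      have h3 : c₀ * Metric.infDist (t j) (⋃ p ∈ Finset.range (N + 1), F p) ≤
          c (P j) * Metric.infDist (t j) (F (P j)) :=
        mul_le_mul (Finset.inf'_le _ (hPN j)) (Metric.infDist_le_infDist_of_subset
          (Set.subset_biUnion_of_mem (u := F) (Finset.mem_coe.2 (hPN j))) (hne _))
          Metric.infDist_nonneg (hc _).le
      calc _ ≤ ‖indI (t j) - -((y j)⁻¹ • (z - y j • indI (t j)))‖ ^ 2 * y j ^ 2 := by
            gcongr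
            exact h3.trans h1
        _ = ‖y j • (indI (t j) - -((y j)⁻¹ • (z - y j • indI (t j))))‖ ^ 2 := by
            rw [norm_smul, mul_pow, Real.norm_eq_abs, sq_abs, mul_comm]
        _ = ‖z‖ ^ 2 := by rw [← h2]
    · rw [div_le_iff₀ hNpos]; linarith [hP2 j]
    · rw [le_div_iff₀ hNpos]; linarith [hP1 j]
    · intro i hi
      rcases lt_or_gt_of_ne hi with h | h
      · left
        rw [le_div_iff₀ hNpos]; linarith [hP1 j, hsep h]
      · right
        rw [div_le_iff₀ hNpos]; linarith [hP2 j, hsep h]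
  · intro i _ j _ hij
    rcases lt_or_gt_of_ne hij with h | h
    · exact hdisj h
    · exact (hdisj h).symm

/-! ### Jumps of step functions -/

/-- The matrix of summation by parts: `y = incrMatrix n *ᵥ x` are the coefficients with
`∑ i, x i • (u (i + 1) - u i) = ∑ j, y j • u j`. Up to sign, `y j` is the jump at `t j` of the step
function with the value `x i` on `(t i, t (i + 1)]`. -/
def incrMatrix (n : ℕ) : Matrix (Fin (n + 1)) (Fin n) ℝ :=
  Matrix.of fun j i => (if j = i.succ then 1 else 0) - if j = i.castSucc then 1 else 0

theorem sum_incrMatrix_mulVec_smul {V : Type*} [AddCommGroup V] [Module ℝ V] {n : ℕ}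
    (x : Fin n → ℝ) (u : Fin (n + 1) → V) :
    ∑ j, (incrMatrix n).mulVec x j • u j = ∑ i, x i • (u i.succ - u i.castSucc) := by
  simp only [Matrix.mulVec, dotProduct, incrMatrix, Matrix.of_apply, Finset.sum_smul]
  rw [Finset.sum_comm]
  refine Finset.sum_congr rfl fun i _ => ?_
  simp [sub_mul, sub_smul, Finset.sum_sub_distrib, ite_smul, smul_sub]

theorem eq_zero_of_incrMatrix_mulVec_eq_zero {n : ℕ} {x : Fin n → ℝ}
    (h : (incrMatrix n).mulVec x = 0) : x = 0 := by
  funext i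
  -- Summation by parts against the indicator of `{j > i}` isolates `x i`.
  have := sum_incrMatrix_mulVec_smul x fun j => if i.castSucc < j then (1 : ℝ) else 0
  have hu : ∀ k : Fin n, ((if i.castSucc < k.succ then (1 : ℝ) else 0) -
      if i.castSucc < k.castSucc then 1 else 0) = if i = k then 1 else 0 := by
    intro k
    rcases lt_trichotomy i k with hik | rfl | hik
    · simp [hik, hik.le, hik.ne]
    · simp
    · simp [hik.not_gt, hik.not_ge, hik.ne']
  simp only [h, hu] at this
  simpa using this.symm

/-- Any `n` of the `n + 1` jumps determine the step function, because all jumps add up to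
zero. -/
theorem det_incrMatrix_submatrix_ne_zero {n : ℕ} (p : Fin (n + 1)) :
    ((incrMatrix n).submatrix p.succAbove id).det ≠ 0 := by
  intro hdet
  obtain ⟨x, hx, h⟩ := Matrix.exists_mulVec_eq_zero_iff.2 hdet
  refine hx (eq_zero_of_incrMatrix_mulVec_eq_zero ?_)
  have hne : ∀ i, (incrMatrix n).mulVec x (p.succAbove i) = 0 := fun i => congrFun h i
  have hsum := sum_incrMatrix_mulVec_smul x fun _ => (1 : ℝ)
  rw [Fin.sum_univ_succAbove _ p] at hsum
  simp only [hne] at hsum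
  funext j
  rcases eq_or_ne j p with rfl | hj
  · simpa using hsum
  · obtain ⟨i, rfl⟩ := Fin.exists_succAbove_eq hj
    exact hne i

theorem prod_prod_succAbove {n : ℕ} (d : Fin (n + 1) → ℝ) :
    ∏ p : Fin (n + 1), ∏ i, d (p.succAbove i) = ∏ j, d j ^ n := by
  have h1 : ∀ p : Fin (n + 1), ∏ i, d (p.succAbove i) = ∏ j, if j = p then 1 else d j := by
    intro p
    rw [Fin.prod_univ_succAbove _ p]
    simp
  simp_rw [h1]
  rw [Finset.prod_comm]
  refine Finset.prod_congr rfl fun j _ => ?_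
  rw [Fin.prod_univ_succAbove _ j]
  simp [(Fin.succAbove_ne j _).symm]

/-! ### The Gram determinant -/

/-- `‖A x‖` dominates the distance from `x` to the kernel of `A`. -/
theorem exists_mul_norm_sub_sq_le {A : L2I →L[ℝ] L2I}
    [FiniteDimensional ℝ (LinearMap.ker (A : L2I →ₗ[ℝ] L2I))] (hinv : ContInvOffKer A) :
    ∃ c > 0, ∀ x, ∃ k ∈ LinearMap.ker (A : L2I →ₗ[ℝ] L2I), c * ‖x - k‖ ^ 2 ≤ ‖A x‖ ^ 2 := by
  obtain ⟨e, he⟩ := hinv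
  let f : LinearMap.range (A : L2I →ₗ[ℝ] L2I) →L[ℝ] (LinearMap.ker (A : L2I →ₗ[ℝ] L2I))ᗮ := e.symm
  set B := ‖f‖ + 1 with hB
  have hBpos : 0 < B := by positivity
  refine ⟨(B ^ 2)⁻¹, by positivity, fun x => ?_⟩
  set k := (LinearMap.ker (A : L2I →ₗ[ℝ] L2I)).starProjection x with hk
  have hkK : k ∈ LinearMap.ker (A : L2I →ₗ[ℝ] L2I) := Submodule.starProjection_apply_mem _ x
  refine ⟨k, hkK, ?_⟩
  set w : (LinearMap.ker (A : L2I →ₗ[ℝ] L2I))ᗮ :=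
    ⟨x - k, Submodule.sub_starProjection_mem_orthogonal x⟩ with hw
  have h1 : ‖x - k‖ ≤ B * ‖A x‖ := by
    have hAx : A x = (e w : L2I) := by
      rw [he w]
      have : A k = 0 := hkK
      simp [hw, this]
    calc ‖x - k‖ = ‖e.symm (e w)‖ := by rw [e.symm_apply_apply]; rfl
      _ ≤ ‖f‖ * ‖e w‖ := f.le_opNorm (e w)
      _ ≤ B * ‖e w‖ := by gcongr; linarith
      _ = B * ‖A x‖ := by rw [hAx]; rfl
  rw [inv_mul_le_iff₀ (by positivity), ← mul_pow]
  gcongr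

theorem dotProduct_gram_gIncr {A : L2I →L[ℝ] L2I} {n : ℕ} (t : Fin (n + 1) → ℝ) (x : Fin n → ℝ) :
    x ⬝ᵥ (Matrix.gram ℝ (gIncr A t)).mulVec x =
      ‖A (∑ j, (incrMatrix n).mulVec x j • indI (t j))‖ ^ 2 := by
  have h := Matrix.star_dotProduct_gram_mulVec (𝕜 := ℝ) (gIncr A t) x x
  rw [star_trivial] at h
  rw [h, real_inner_self_eq_norm_sq, sum_incrMatrix_mulVec_smul, map_sum]
  simp [gIncr, gCurve]

/-- The Gram determinant dominates `∏ j, dist (t j, F) ^ (n / (n + 1))`: this is the geometric mean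
over `p` of the bounds by `∏ j ≠ p, dist (t j, F)` that one gets by discarding the jump at `t p`. -/
theorem exists_prod_infDist_pow_le_gramDet_pow {A : L2I →L[ℝ] L2I}
    [FiniteDimensional ℝ (LinearMap.ker (A : L2I →ₗ[ℝ] L2I))] (hinv : ContInvOffKer A) (n : ℕ)
    {δ : ℝ} (hδ : 0 < δ) :
    ∃ F : Set ℝ, F.Finite ∧ F.Nonempty ∧ ∃ C > 0, ∀ t ∈ simplexOff n δ,
      C * ∏ j, Metric.infDist (t j) F ^ n ≤ gramDet (gIncr A t) ^ (n + 1) := by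
  obtain ⟨a, ha, hA⟩ := exists_mul_norm_sub_sq_le hinv
  obtain ⟨F, hF, hne, c, hc, h⟩ :=
    exists_finite_sum_infDist_le (LinearMap.ker (A : L2I →ₗ[ℝ] L2I)) n hδ
  set D : Fin (n + 1) → ℝ := fun p => ((incrMatrix n).submatrix p.succAbove id).det with hD
  have hDne : ∀ p, D p ≠ 0 := fun p => det_incrMatrix_submatrix_ne_zero p
  refine ⟨F, hF, hne, ∏ p, ((a * c) ^ n * D p ^ 2), Finset.prod_pos fun p _ =>
    mul_pos (by positivity) (sq_pos_of_ne_zero (hDne p)), fun t ht => ?_⟩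
  set d : Fin (n + 1) → ℝ := fun j => Metric.infDist (t j) F with hd
  have hd0 : ∀ j, 0 ≤ d j := fun j => Metric.infDist_nonneg
  have key : ∀ p : Fin (n + 1), (a * c) ^ n * D p ^ 2 * ∏ i, d (p.succAbove i) ≤
      gramDet (gIncr A t) := by
    intro p
    have hdet := sq_det_le_det_of_sum_sq_le
      (M := Matrix.gram ℝ (gIncr A t))
      (S := Matrix.diagonal (fun i => √(a * c * d (p.succAbove i))) *
        (incrMatrix n).submatrix p.succAbove id) (Matrix.isHermitian_gram ℝ _) ?_
    · rw [Matrix.det_mul, Matrix.det_diagonal, mul_pow, ← Finset.prod_pow] at hdet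
      refine le_trans (le_of_eq ?_) hdet
      have : ∀ i, √(a * c * d (p.succAbove i)) ^ 2 = a * c * d (p.succAbove i) := fun i =>
        Real.sq_sqrt (mul_nonneg (by positivity) (hd0 _))
      simp_rw [this]
      rw [Finset.prod_mul_distrib, Finset.prod_const, Finset.card_univ, Fintype.card_fin]
      ring
    · intro x
      obtain ⟨k, hk, hAk⟩ := hA (∑ j, (incrMatrix n).mulVec x j • indI (t j))
      have h1 := h t ht ((incrMatrix n).mulVec x) k hk
      rw [dotProduct_gram_gIncr]
      refine le_trans ?_ hAk
      refine le_trans ?_ (mul_le_mul_of_nonneg_left h1 ha.le)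
      rw [Fin.sum_univ_succAbove _ p, mul_add, Finset.mul_sum]
      refine le_trans (le_of_eq ?_) (le_add_of_nonneg_left (mul_nonneg ha.le
        (mul_nonneg (mul_nonneg hc.le (hd0 p)) (sq_nonneg _))))
      refine Finset.sum_congr rfl fun i _ => ?_
      rw [← Matrix.mulVec_mulVec, Matrix.mulVec_diagonal, mul_pow,
        Real.sq_sqrt (mul_nonneg (by positivity) (hd0 _))]
      change _ * (incrMatrix n).mulVec x (p.succAbove i) ^ 2 = _
      ring
  calc _ = ∏ p, ((a * c) ^ n * D p ^ 2 * ∏ i, d (p.succAbove i)) := by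
        rw [Finset.prod_mul_distrib (f := fun p => (a * c) ^ n * D p ^ 2), prod_prod_succAbove]
    _ ≤ ∏ p : Fin (n + 1), gramDet (gIncr A t) := by
        refine Finset.prod_le_prod (fun p _ => ?_) fun p _ => key p
        exact mul_nonneg (by positivity) (Finset.prod_nonneg fun i _ => hd0 _)
    _ = gramDet (gIncr A t) ^ (n + 1) := by simp

/-- Passage to reciprocals and `(n + 1)`-st roots in `[0, ∞]`, where the `d j` may vanish. -/
theorem one_div_ofReal_le_of_mul_prod_pow_le {n : ℕ} {C G : ℝ} (hC : 0 < C) (hG : 0 ≤ G)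
    {d : Fin (n + 1) → ℝ} (hd : ∀ j, 0 ≤ d j) (h : C * ∏ j, d j ^ n ≤ G ^ (n + 1)) :
    1 / ENNReal.ofReal G ≤ (ENNReal.ofReal C ^ ((n + 1 : ℝ)⁻¹))⁻¹ *
      ∏ j, ENNReal.ofReal (d j) ^ (-(n / (n + 1) : ℝ)) := by
  have hn : (0 : ℝ) < n + 1 := by positivity
  have h1 := ENNReal.ofReal_le_ofReal h
  rw [ENNReal.ofReal_mul hC.le, ENNReal.ofReal_prod_of_nonneg fun j _ => pow_nonneg (hd j) n,
    ENNReal.ofReal_pow hG] at h1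
  have h2 := ENNReal.rpow_le_rpow h1 (inv_nonneg.2 hn.le)
  rw [ENNReal.mul_rpow_of_nonneg _ _ (inv_nonneg.2 hn.le),
    ← ENNReal.prod_rpow_of_nonneg (inv_nonneg.2 hn.le)] at h2
  have h3 : (ENNReal.ofReal G ^ (n + 1)) ^ ((n + 1 : ℝ)⁻¹) = ENNReal.ofReal G := by
    rw [← ENNReal.rpow_natCast, ← ENNReal.rpow_mul, Nat.cast_add_one, mul_inv_cancel₀ hn.ne',
      ENNReal.rpow_one]
  have h4 : ∀ j, ENNReal.ofReal (d j ^ n) ^ ((n + 1 : ℝ)⁻¹) =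
      ENNReal.ofReal (d j) ^ (n / (n + 1) : ℝ) := fun j => by
    rw [ENNReal.ofReal_pow (hd j), ← ENNReal.rpow_natCast, ← ENNReal.rpow_mul, div_eq_mul_inv]
  rw [h3] at h2
  simp_rw [h4] at h2
  rw [one_div]
  refine (ENNReal.inv_le_inv.2 h2).trans (le_of_eq ?_)
  have h5 : ENNReal.ofReal C ^ ((n + 1 : ℝ)⁻¹) ≠ 0 := by
    simp [ENNReal.rpow_eq_zero_iff, hC]
  have h6 : ENNReal.ofReal C ^ ((n + 1 : ℝ)⁻¹) ≠ ∞ :=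
    ENNReal.rpow_ne_top_of_nonneg (inv_nonneg.2 hn.le) ENNReal.ofReal_ne_top
  rw [ENNReal.mul_inv (Or.inl h5) (Or.inl h6), ENNReal.prod_inv_distrib]
  · simp_rw [ENNReal.rpow_neg]
  · intro i _ j _ _
    exact Or.inr (ENNReal.rpow_ne_top_of_nonneg (by positivity) ENNReal.ofReal_ne_top)

/-- Here `k = n + 1 ≥ 1`. The integral is that of a `[0, ∞]`-valued function, with `1 / 0 = ∞`. -/
theorem theorem3 (A : L2I →L[ℝ] L2I)
    (hker : FiniteDimensional ℝ (LinearMap.ker (A : L2I →ₗ[ℝ] L2I)))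
    (hinv : ContInvOffKer A) (n : ℕ) (δ : ℝ) (hδ : 0 < δ) :
    ∫⁻ t in simplexOff n δ, 1 / ENNReal.ofReal (gramDet (gIncr A t))
      ∂(volume : Measure (Fin (n + 1) → ℝ)) < ∞ := by
  obtain ⟨F, hF, hne, C, hC, h⟩ := exists_prod_infDist_pow_le_gramDet_pow hinv n hδ
  set f : ℝ → ℝ≥0∞ := fun s => ENNReal.ofReal (Metric.infDist s F) ^ (-(n / (n + 1) : ℝ)) with hf
  have hfm : Measurable f := (Metric.continuous_infDist_pt F).measurable.ennreal_ofReal.pow_const _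
  have hθ : (n / (n + 1) : ℝ) < 1 := by
    rw [div_lt_one (by positivity)]; linarith
  have hsub : simplexOff n δ ⊆ Set.univ.pi fun _ => Set.Icc (0 : ℝ) 1 := fun t ht j _ => ht.1.2 j
  set c := (ENNReal.ofReal C ^ ((n + 1 : ℝ)⁻¹))⁻¹ with hc
  have hc_top : c ≠ ∞ := by
    rw [hc]
    simp [ENNReal.rpow_eq_zero_iff, hC]
  calc ∫⁻ t in simplexOff n δ, 1 / ENNReal.ofReal (gramDet (gIncr A t))
      ≤ ∫⁻ t in simplexOff n δ, c * ∏ j, f (t j) := by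
        refine setLIntegral_mono (by fun_prop) fun t ht => ?_
        exact one_div_ofReal_le_of_mul_prod_pow_le hC (Matrix.posSemidef_gram ℝ _).det_nonneg
          (fun j => Metric.infDist_nonneg) (h t ht)
    _ ≤ ∫⁻ t in Set.univ.pi fun _ : Fin (n + 1) => Set.Icc (0 : ℝ) 1, c * ∏ j, f (t j) :=
        lintegral_mono_set hsub
    _ = c * (∫⁻ s in Set.Icc (0 : ℝ) 1, f s) ^ (n + 1) := by
        rw [lintegral_const_mul _ (by fun_prop), volume_pi, Measure.restrict_pi_pi,
          lintegral_pi_prod_eq_pow hfm]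
    _ < ∞ := ENNReal.mul_lt_top hc_top.lt_top
        (ENNReal.pow_lt_top (lintegral_infDist_rpow_neg_lt_top hF hne hθ))
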